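/- A Steiner triple system STS($v$) is a pair $(V,\mathcal B)$, where $|V|=v$ and $\mathcal B$ is a set of 3-subsets of $V$ (triples) such that any two distinct points of $V$ lie together in exactly one triple. A strict $k$-bicoloring of it is a surjective map from $V$ onto a set of $k$ colors under which every triple receives exactly two colors. The lower (upper) chromatic number $\chi$ ($\bar\chi$) is the least (greatest) $k$ for which a strict $k$-bicoloring exists. Given an STS($v$) $(V,\mathcal B)$ with $V=\{a_1,\dots,a_v\}$, a set $X$ disjoint from $V$ with $|X|=v+1$, and a 1-factorization $\{F_1,\dots,F_v\}$ of the complete graph on $X$, the doubling construction yields the STS($2v+1$) on $V\cup X$ whose triples are those of $\mathcal B$ together with all $\{a_i,x,y\}$ with $\{x,y\}\in F_i$. An extended bicoloring of an STS($2v+1$) so obtained is, for some $k$, a strict $k$-bicoloring of it whose restriction to $V$ is a strict $k$-bicoloring of $(V,\mathcal B)$; that is, the points of $X$ receive only colors already used on $V$. Theorem 10. Let $\Omega=\{27,39,43,55,79,87,91,99,103,111,127,135,151,159,175\}$. For every $w\in\Omega$ there exists an STS($w$) which is obtained by the doubling construction from an STS($\frac{w-1}{2}$) and has an extended bicoloring,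 and for which $\chi\neq\bar\chi$. -/

import Mathlib

/-- A Steiner triple system on the point set `V`: a collection of 3-subsets (triples) of `V` such
that any two distinct points lie together in exactly one triple.  It is an STS(v) if `V` has `v`
elements. -/
structure SteinerTripleSystem (V : Type) where
  /-- the triples -/
  triples : Set (Finset V)
  card_eq_three : ∀ B ∈ triples, B.card = 3
  existsUnique_triple : ∀ x y : V, x ≠ y → ∃! B : Finset V, B ∈ triples ∧ x ∈ B ∧ y ∈ B

/-- A 1-factorization of the complete graph on `X`, with its 1-factors (perfect matchings) indexed
by `ι`: every edge of the complete graph lies in exactly one of the 1-factors. -/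
structure OneFactorization (ι X : Type) where
  /-- the 1-factors -/
  factor : ι → (⊤ : SimpleGraph X).Subgraph
  isPerfectMatching : ∀ i, (factor i).IsPerfectMatching
  existsUnique_factor : ∀ x y : X, x ≠ y → ∃! i, (factor i).Adj x y

namespace SteinerTripleSystem

variable {V X W C : Type}

/-- `φ` is a bicoloring of `S`: every triple receives exactly two colors. -/
def IsBicoloring [DecidableEq C] (S : SteinerTripleSystem V) (φ : V → C) : Prop :=
  ∀ B ∈ S.triples, (B.image φ).card = 2

/-- `φ` is a strict `k`-bicoloring of `S`: a bicoloring in which exactly `k` colors, named by the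
elements of `Fin k`, are used. -/
def IsStrictBicoloring (S : SteinerTripleSystem V) {k : ℕ} (φ : V → Fin k) : Prop :=
  S.IsBicoloring φ ∧ Function.Surjective φ

/-- The numbers `k` such that `S` has a strict `k`-bicoloring. -/
def bicoloringNumbers (S : SteinerTripleSystem V) : Set ℕ :=
  {k | ∃ φ : V → Fin k, S.IsStrictBicoloring φ}

/-- `m` is the lower chromatic number of `S`. -/
def IsLowerChromaticNumber (S : SteinerTripleSystem V) (m : ℕ) : Prop :=
  IsLeast S.bicoloringNumbers m

/-- `m` is the upper chromatic number of `S`. -/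
def IsUpperChromaticNumber (S : SteinerTripleSystem V) (m : ℕ) : Prop :=
  IsGreatest S.bicoloringNumbers m

/-- `T` is the system obtained by the doubling construction from `S` and the 1-factorization `F` of
the complete graph on `X`, when the disjoint union of `V` and `X` is identified with the point set
of `T` by `e`: the triples of `T` are those of `S` and the sets `{a, x, y}` where `a` is a point of
`S` and `{x, y}` is an edge of the 1-factor of `a`. -/
def IsDoubling (T : SteinerTripleSystem W) (S : SteinerTripleSystem V) (F : OneFactorization V X)
    (e : V ⊕ X ≃ W) : Prop :=
  ∀ B : Finset W, B ∈ T.triples ↔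
    (∃ A ∈ S.triples, (B : Set W) = (fun a => e (Sum.inl a)) '' (A : Set V)) ∨
    (∃ (a : V) (x y : X), (F.factor a).Adj x y ∧
      (B : Set W) = {e (Sum.inl a), e (Sum.inr x), e (Sum.inr y)})

/-- `T` has an extended bicoloring: `T` is obtained by the doubling construction from an STS(v) and
a 1-factorization of the complete graph on `v + 1` vertices, and for some `k` there is a strict
`k`-bicoloring of `T` whose restriction to the STS(v) is a strict `k`-bicoloring of the STS(v), so
that the new points receive no color which is not already used on the STS(v). -/
def HasExtendedBicoloring (T : SteinerTripleSystem W) : Prop :=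
  ∃ (v : ℕ) (S : SteinerTripleSystem (Fin v)) (F : OneFactorization (Fin v) (Fin (v + 1)))
    (e : Fin v ⊕ Fin (v + 1) ≃ W), T.IsDoubling S F e ∧
    ∃ (k : ℕ) (φ : Fin v → Fin k) (ψ : W → Fin k),
      S.IsStrictBicoloring φ ∧ T.IsStrictBicoloring ψ ∧ ∀ a : Fin v, ψ (e (Sum.inl a)) = φ a

end SteinerTripleSystem

/-!
Consider an STS(`v`) on `V` and a 1-factorization on `X`, with colorings `φ` of `V` and `ψ` of `X`
that bicolor the doubling, where `ψ` uses only colors of `φ`. The doubling then has an extended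
`k`-bicoloring and, with one fresh color on all of `X`, also a `(k + 1)`-bicoloring, so its two
chromatic numbers differ.

Such a configuration for `v` gives one for `2 * v + 1`. Take the doubling itself, colored by `φ`
and one fresh color `c`; on two copies of `X`, repeat each old 1-factor on both copies and join
`x` in the first copy to `g - x` in the second for each `g` in an abelian group structure on `X`.
Color the first copy `c` and the second one by `ψ`: the edges inside the copies are
`{φ i, c, c}` and `{φ i, ψ x, ψ y}`, and those between the copies are `{c, c, ψ y}`. As `v + 1`
doubles each time, finitely many base cases suffice; these were found by a computer search among
the designs with a prescribed automorphism.
-/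

variable {V W X Y ι κ C D : Type}

namespace SteinerTripleSystem

/-- The system obtained from `S` by renaming its points along `e`. -/
def map (S : SteinerTripleSystem V) (e : V ≃ W) : SteinerTripleSystem W where
  triples := {B | B.map e.symm.toEmbedding ∈ S.triples}
  card_eq_three B hB := by simpa using S.card_eq_three _ hB
  existsUnique_triple x y hxy := by
    obtain ⟨A, ⟨hA, hx, hy⟩, hA'⟩ :=
      S.existsUnique_triple (e.symm x) (e.symm y) (e.symm.injective.ne hxy)
    refine ⟨A.map e.toEmbedding, ⟨?_, by simpa using hx, by simpa using hy⟩, fun B hB => ?_⟩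
    · simpa [Finset.map_map] using hA
    · rw [← hA' (B.map e.symm.toEmbedding) (by simpa using hB)]
      simp [Finset.map_map]

variable {S : SteinerTripleSystem V}

theorem map_mem_triples_map {e : V ≃ W} {A : Finset V} :
    A.map e.toEmbedding ∈ (S.map e).triples ↔ A ∈ S.triples := by
  simp [map, Finset.map_map]

theorem isBicoloring_comp_iff [DecidableEq C] [DecidableEq D] {φ : V → C} {g : C → D}
    (hg : Function.Injective g) : S.IsBicoloring (g ∘ φ) ↔ S.IsBicoloring φ := by
  simp only [IsBicoloring, ← Finset.image_image, Finset.card_image_of_injective _ hg]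

theorem IsBicoloring.map [DecidableEq C] {φ : V → C} (h : S.IsBicoloring φ) (e : V ≃ W) :
    (S.map e).IsBicoloring (φ ∘ e.symm) := by
  classical
  intro B hB
  simpa [Finset.map_eq_image, Finset.image_image] using h _ hB

theorem exists_strictBicoloring [Finite V] [DecidableEq C] {φ : V → C} (h : S.IsBicoloring φ) :
    ∃ (f : V → Fin (Set.range φ).ncard) (g : Fin (Set.range φ).ncard → C),
      Function.Injective g ∧ g ∘ f = φ ∧ S.IsStrictBicoloring f := by
  let e := Finite.equivFinOfCardEq (Nat.card_coe_set_eq (Set.range φ))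
  have hg : Function.Injective (Subtype.val ∘ e.symm) :=
    Subtype.val_injective.comp e.symm.injective
  have hgf : (Subtype.val ∘ e.symm) ∘ (e ∘ Set.rangeFactorization φ) = φ :=
    funext fun x => congrArg Subtype.val (e.symm_apply_apply _)
  exact ⟨e ∘ Set.rangeFactorization φ, Subtype.val ∘ e.symm, hg, hgf,
    (isBicoloring_comp_iff hg).1 (hgf.symm ▸ h),
    e.surjective.comp Set.rangeFactorization_surjective⟩

theorem IsBicoloring.ncard_range_mem_bicoloringNumbers [Finite V] [DecidableEq C] {φ : V → C}
    (h : S.IsBicoloring φ) : (Set.range φ).ncard ∈ S.bicoloringNumbers :=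
  let ⟨f, _, _, _, hf⟩ := exists_strictBicoloring h
  ⟨f, hf⟩

theorem bddAbove_bicoloringNumbers [Finite V] (S : SteinerTripleSystem V) :
    BddAbove S.bicoloringNumbers := by
  refine ⟨Nat.card V, ?_⟩
  rintro k ⟨φ, -, hφ⟩
  simpa using Nat.card_le_card_of_surjective φ hφ

theorem exists_lower_ne_upper [Finite V] {k l : ℕ} (hk : k ∈ S.bicoloringNumbers)
    (hl : l ∈ S.bicoloringNumbers) (hkl : k < l) :
    ∃ m n, S.IsLowerChromaticNumber m ∧ S.IsUpperChromaticNumber n ∧ m ≠ n := by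
  have hbdd := S.bddAbove_bicoloringNumbers
  refine ⟨sInf S.bicoloringNumbers, sSup S.bicoloringNumbers,
    ⟨Nat.sInf_mem ⟨k, hk⟩, fun _ h => Nat.sInf_le h⟩,
    ⟨Nat.sSup_mem ⟨k, hk⟩ hbdd, fun _ h => le_csSup hbdd h⟩, ?_⟩
  exact ((Nat.sInf_le hk).trans_lt (hkl.trans_le (le_csSup hbdd hl))).ne

end SteinerTripleSystem

theorem existsUnique_inl {p : V ⊕ W → Prop} (h : ∃! a, p (Sum.inl a))
    (h' : ∀ b, ¬p (Sum.inr b)) : ∃! s, p s := by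
  obtain ⟨a, ha, huniq⟩ := h
  refine ⟨Sum.inl a, ha, ?_⟩
  rintro (b | b) hb
  · exact congrArg Sum.inl (huniq b hb)
  · exact (h' b hb).elim

theorem existsUnique_inr {p : V ⊕ W → Prop} (h : ∃! b, p (Sum.inr b))
    (h' : ∀ a, ¬p (Sum.inl a)) : ∃! s, p s := by
  obtain ⟨b, hb, huniq⟩ := h
  refine ⟨Sum.inr b, hb, ?_⟩
  rintro (a | a) ha
  · exact (h' a ha).elim
  · exact congrArg Sum.inr (huniq a ha)

theorem existsUnique_add_eq [AddCommGroup X] (x g : X) : ∃! y, x + y = g :=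
  ⟨g - x, add_sub_cancel x g, fun _ h => eq_sub_of_add_eq' h⟩

namespace OneFactorization

/-- The 1-factorization whose factor with index `i` has the edge `{x, y}` if and only if
`adj i x y`. -/
def ofAdj (adj : ι → X → X → Prop) (symm : ∀ i x y, adj i x y → adj i y x)
    (irrefl : ∀ i x, ¬adj i x x) (partner : ∀ i x, ∃! y, adj i x y)
    (index : ∀ x y, x ≠ y → ∃! i, adj i x y) : OneFactorization ι X where
  factor i :=
    { verts := Set.univ
      Adj := adj i
      adj_sub := by rintro x _ h rfl; exact irrefl i x h
      edge_vert := fun _ => Set.mem_univ _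
      symm := ⟨symm i⟩ }
  isPerfectMatching i := SimpleGraph.Subgraph.isPerfectMatching_iff.2 (partner i)
  existsUnique_factor := index

theorem existsUnique_adj (F : OneFactorization ι X) (i : ι) (x : X) :
    ∃! y, (F.factor i).Adj x y :=
  SimpleGraph.Subgraph.isPerfectMatching_iff.1 (F.isPerfectMatching i) x

/-- The 1-factorization obtained from `F` by renaming its factors along `e` and its vertices
along `f`. -/
def map (F : OneFactorization ι X) (e : ι ≃ κ) (f : X ≃ Y) : OneFactorization κ Y :=
  ofAdj (fun i x y => (F.factor (e.symm i)).Adj (f.symm x) (f.symm y)) (fun _ _ _ h => h.symm)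
    (fun _ _ h => h.ne rfl)
    (fun i x => (f.symm.bijective.existsUnique_iff).1 (F.existsUnique_adj (e.symm i) (f.symm x)))
    fun x y hxy => (e.symm.bijective.existsUnique_iff).1
      (F.existsUnique_factor (f.symm x) (f.symm y) (f.symm.injective.ne hxy))

/-- A coloring `φ` of the factors and a coloring `ψ` of the vertices form a bicoloring of `F` if
every edge `{x, y}` of a factor `i` receives, together with `i`, exactly two colors; these are the
colorings of the new triples `{i, x, y}` of the doubling construction. -/
def IsBicoloring [DecidableEq C] (F : OneFactorization ι X) (φ : ι → C) (ψ : X → C) : Prop :=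
  ∀ i x y, (F.factor i).Adj x y → ({φ i, ψ x, ψ y} : Finset C).card = 2

variable {F : OneFactorization ι X}

theorem IsBicoloring.map [DecidableEq C] {φ : ι → C} {ψ : X → C} (h : F.IsBicoloring φ ψ)
    (e : ι ≃ κ) (f : X ≃ Y) : (F.map e f).IsBicoloring (φ ∘ e.symm) (ψ ∘ f.symm) :=
  fun _ _ _ hxy => h _ _ _ hxy

theorem isBicoloring_const (F : OneFactorization ι X) [DecidableEq C] {φ : ι → C} {c : C}
    (hc : c ∉ Set.range φ) : F.IsBicoloring φ fun _ => c := by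
  intro i _ _ _
  rw [Finset.pair_eq_singleton, Finset.card_pair fun h => hc ⟨i, h⟩]

/-- A 1-factorization on two copies of `X`: each factor of `F` is repeated on both copies, and the
`|X|` additional factors, indexed by an abelian group structure on `X`, join `x` in the first copy
to `g - x` in the second one. -/
def double [AddCommGroup X] (F : OneFactorization ι X) : OneFactorization (ι ⊕ X) (X ⊕ X) :=
  ofAdj
    (fun
      | .inl i, .inl x, .inl y => (F.factor i).Adj x y
      | .inl i, .inr x, .inr y => (F.factor i).Adj x y
      | .inr g, .inl x, .inr y => x + y = g
      | .inr g, .inr x, .inl y => x + y = g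
      | _, _, _ => False)
    (by
      rintro (i | g) (x | x) (y | y) h
      all_goals first | exact h.symm | exact (add_comm _ _).trans h | exact h)
    (by
      rintro (i | g) (x | x) h
      all_goals first | exact h.ne rfl | exact h)
    (by
      rintro (i | g) (x | x)
      · exact existsUnique_inl (F.existsUnique_adj i x) fun _ h => h
      · exact existsUnique_inr (F.existsUnique_adj i x) fun _ h => h
      · exact existsUnique_inr (existsUnique_add_eq x g) fun _ h => h
      · exact existsUnique_inl (existsUnique_add_eq x g) fun _ h => h)
    (by
      rintro (x | x) (y | y) hxy
      · exact existsUnique_inl (F.existsUnique_factor x y fun h => hxy (h ▸ rfl)) fun _ h => h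
      · exact existsUnique_inr existsUnique_eq' fun _ h => h
      · exact existsUnique_inr existsUnique_eq' fun _ h => h
      · exact existsUnique_inl (F.existsUnique_factor x y fun h => hxy (h ▸ rfl)) fun _ h => h)

theorem IsBicoloring.double [AddCommGroup X] [DecidableEq C] {φ : ι → C} {ψ : X → C} {c : C}
    (h : F.IsBicoloring φ ψ) (hφ : c ∉ Set.range φ) (hψ : c ∉ Set.range ψ) :
    F.double.IsBicoloring (Sum.elim φ fun _ => c) (Sum.elim (fun _ => c) ψ) := by
  have hφ' : ∀ i, φ i ≠ c := fun i hi => hφ ⟨i, hi⟩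
  have hψ' : ∀ x, c ≠ ψ x := fun x hx => hψ ⟨x, hx.symm⟩
  rintro (i | g) (x | x) (y | y) hxy
  · simp [hφ']
  · exact hxy.elim
  · exact hxy.elim
  · exact h i x y hxy
  · exact hxy.elim
  · simp [hψ']
  · simp [Finset.pair_comm (ψ x) c, hψ']
  · exact hxy.elim

end OneFactorization

namespace SteinerTripleSystem

variable {S : SteinerTripleSystem V} {F : OneFactorization V X}

section Double

variable [DecidableEq V] [DecidableEq X]

/-- The triples of the doubling construction, on the disjoint union of the old and the new
points. -/
def doubleTriples (S : SteinerTripleSystem V) (F : OneFactorization V X) : Set (Finset (V ⊕ X)) :=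
  {B | (∃ A ∈ S.triples, A.map .inl = B) ∨
    ∃ a x y, (F.factor a).Adj x y ∧ {.inl a, .inr x, .inr y} = B}

theorem existsUnique_doubleTriples_inl_inl {a b : V} (hab : a ≠ b) :
    ∃! B, B ∈ S.doubleTriples F ∧ .inl a ∈ B ∧ .inl b ∈ B := by
  obtain ⟨A, hA, huniq⟩ := S.existsUnique_triple a b hab
  refine ⟨A.map .inl, ⟨.inl ⟨A, hA.1, rfl⟩, by simpa using hA.2⟩, ?_⟩
  rintro _ ⟨⟨A', hA', rfl⟩ | ⟨c, x, y, -, rfl⟩, ha, hb⟩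
  · rw [huniq A' ⟨hA', by simpa using ha, by simpa using hb⟩]
  · simp only [Finset.mem_insert, Finset.mem_singleton, reduceCtorEq, or_false,
      Sum.inl.injEq] at ha hb
    exact (hab (ha.trans hb.symm)).elim

theorem existsUnique_doubleTriples_inl_inr (a : V) (x : X) :
    ∃! B, B ∈ S.doubleTriples F ∧ .inl a ∈ B ∧ .inr x ∈ B := by
  obtain ⟨y, hy, huniq⟩ := F.existsUnique_adj a x
  refine ⟨{.inl a, .inr x, .inr y}, ⟨.inr ⟨a, x, y, hy, rfl⟩, by simp⟩, ?_⟩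
  rintro _ ⟨⟨A, -, rfl⟩ | ⟨b, x', y', hxy, rfl⟩, ha, hx⟩
  · simp at hx
  · obtain rfl : a = b := by simpa using ha
    obtain rfl | rfl : x = x' ∨ x = y' := by simpa using hx
    · rw [huniq y' hxy]
    · rw [huniq x' hxy.symm, Finset.pair_comm]

theorem existsUnique_doubleTriples_inr_inr {x y : X} (hxy : x ≠ y) :
    ∃! B, B ∈ S.doubleTriples F ∧ .inr x ∈ B ∧ .inr y ∈ B := by
  obtain ⟨a, ha, huniq⟩ := F.existsUnique_factor x y hxy
  refine ⟨{.inl a, .inr x, .inr y}, ⟨.inr ⟨a, x, y, ha, rfl⟩, by simp⟩, ?_⟩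
  rintro _ ⟨⟨A, -, rfl⟩ | ⟨b, x', y', hb, rfl⟩, hx, hy⟩
  · simp at hx
  · simp only [Finset.mem_insert, Finset.mem_singleton, reduceCtorEq, false_or,
      Sum.inr.injEq] at hx hy
    rcases hx with rfl | rfl <;> rcases hy with rfl | rfl
    · exact (hxy rfl).elim
    · rw [huniq b hb]
    · rw [huniq b hb.symm, Finset.pair_comm]
    · exact (hxy rfl).elim

/-- The doubling construction, on the disjoint union of the old and the new points. -/
def double (S : SteinerTripleSystem V) (F : OneFactorization V X) :
    SteinerTripleSystem (V ⊕ X) where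
  triples := S.doubleTriples F
  card_eq_three := by
    rintro _ (⟨A, hA, rfl⟩ | ⟨a, x, y, hxy, rfl⟩)
    · simpa using S.card_eq_three A hA
    · simp [hxy.ne]
  existsUnique_triple := by
    rintro (a | x) (b | y) hne
    · exact existsUnique_doubleTriples_inl_inl fun h => hne (h ▸ rfl)
    · exact existsUnique_doubleTriples_inl_inr a y
    · simpa only [and_comm] using existsUnique_doubleTriples_inl_inr b x
    · exact existsUnique_doubleTriples_inr_inr fun h => hne (h ▸ rfl)

theorem IsBicoloring.double [DecidableEq C] {φ : V → C} {ψ : X → C} (hS : S.IsBicoloring φ)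
    (hF : F.IsBicoloring φ ψ) : (S.double F).IsBicoloring (Sum.elim φ ψ) := by
  rintro _ (⟨A, hA, rfl⟩ | ⟨a, x, y, hxy, rfl⟩)
  · rw [Finset.map_eq_image, Finset.image_image]
    exact hS A hA
  · simpa [Finset.image_insert] using hF a x y hxy

theorem isDoubling_map_double (e : V ⊕ X ≃ W) : ((S.double F).map e).IsDoubling S F e := by
  intro B
  obtain ⟨B, rfl⟩ := e.finsetCongr.surjective B
  have coe_eq_image_iff (A : Finset (V ⊕ X)) :
      (e.finsetCongr B : Set W) = e '' A ↔ A = B := by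
    rw [Equiv.finsetCongr_apply, Finset.coe_map, Equiv.coe_toEmbedding,
      e.injective.image_injective.eq_iff, Finset.coe_inj, eq_comm]
  refine map_mem_triples_map.trans (or_congr ?_ ?_)
  · refine exists_congr fun A => and_congr_right' ?_
    rw [← coe_eq_image_iff, Finset.coe_map, Set.image_image]
    rfl
  · refine exists₃_congr fun a x y => and_congr_right' ?_
    rw [← coe_eq_image_iff]
    simp [Set.image_insert_eq]

end Double

theorem hasExtendedBicoloring_map_double {v : ℕ} {S : SteinerTripleSystem (Fin v)}
    {F : OneFactorization (Fin v) (Fin (v + 1))} [DecidableEq C] {φ : Fin v → C}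
    {ψ : Fin (v + 1) → C} (hS : S.IsBicoloring φ) (hF : F.IsBicoloring φ ψ)
    (hψ : Set.range ψ ⊆ Set.range φ) (e : Fin v ⊕ Fin (v + 1) ≃ W) :
    ((S.double F).map e).HasExtendedBicoloring := by
  have : Finite W := .of_equiv _ e
  obtain ⟨f, g, hg, hgf, hf⟩ := exists_strictBicoloring ((hS.double hF).map e)
  have hgf' (s) : g (f (e s)) = Sum.elim φ ψ s := by
    simpa using congrFun hgf (e s)
  have hfφ : g ∘ (fun a => f (e (.inl a))) = φ := funext fun a => hgf' (.inl a)
  refine ⟨v, S, F, e, isDoubling_map_double e, _, fun a => f (e (.inl a)), f,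
    ⟨(isBicoloring_comp_iff hg).1 (hfφ.symm ▸ hS), fun k => ?_⟩, hf, fun _ => rfl⟩
  obtain ⟨w, rfl⟩ := hf.2 k
  obtain ⟨a | x, rfl⟩ := e.surjective w
  · exact ⟨a, rfl⟩
  · obtain ⟨a, ha⟩ := hψ ⟨x, rfl⟩
    exact ⟨a, hg ((hgf' (.inl a)).trans (ha.trans (hgf' (.inr x)).symm))⟩

theorem exists_lower_ne_upper_map_double [Finite V] [Finite X] [Nonempty X] [DecidableEq V]
    [DecidableEq X] [DecidableEq C] [Infinite C] {φ : V → C} {ψ : X → C} (hS : S.IsBicoloring φ)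
    (hF : F.IsBicoloring φ ψ) (hψ : Set.range ψ ⊆ Set.range φ) (e : V ⊕ X ≃ W) :
    ∃ m n, ((S.double F).map e).IsLowerChromaticNumber m ∧
      ((S.double F).map e).IsUpperChromaticNumber n ∧ m ≠ n := by
  have : Finite W := .of_equiv _ e
  obtain ⟨c, hc⟩ := (Set.finite_range φ).exists_notMem
  refine exists_lower_ne_upper
    ((hS.double hF).map e).ncard_range_mem_bicoloringNumbers
    ((hS.double (F.isBicoloring_const hc)).map e).ncard_range_mem_bicoloringNumbers ?_
  simp only [EquivLike.range_comp, Set.Sum.elim_range, Set.range_const, Set.union_singleton,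
    Set.union_eq_left.2 hψ]
  rw [Set.ncard_insert_of_notMem hc]
  exact Nat.lt_succ_self _

end SteinerTripleSystem

/-- An STS(`v`) and a 1-factorization of the complete graph on `v + 1` vertices whose double has a
bicoloring without colors that occur on the new points only. -/
def HasBicoloredDoubling (v : ℕ) : Prop :=
  ∃ (S : SteinerTripleSystem (Fin v)) (F : OneFactorization (Fin v) (Fin (v + 1)))
    (φ : Fin v → ℕ) (ψ : Fin (v + 1) → ℕ),
    S.IsBicoloring φ ∧ F.IsBicoloring φ ψ ∧ Set.range ψ ⊆ Set.range φ

namespace HasBicoloredDoubling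

variable {v : ℕ}

theorem of_card [Finite V] [Finite X] {S : SteinerTripleSystem V} {F : OneFactorization V X}
    {φ : V → ℕ} {ψ : X → ℕ} (hV : Nat.card V = v) (hX : Nat.card X = v + 1)
    (hS : S.IsBicoloring φ) (hF : F.IsBicoloring φ ψ) (hψ : Set.range ψ ⊆ Set.range φ) :
    HasBicoloredDoubling v := by
  let e := Finite.equivFinOfCardEq hV
  let f := Finite.equivFinOfCardEq hX
  refine ⟨S.map e, F.map e f, φ ∘ e.symm, ψ ∘ f.symm, hS.map e, hF.map e f, ?_⟩
  simpa only [EquivLike.range_comp] using hψ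

theorem double (h : HasBicoloredDoubling v) : HasBicoloredDoubling (2 * v + 1) := by
  obtain ⟨S, F, φ, ψ, hS, hF, hψ⟩ := h
  obtain ⟨c, hc⟩ := (Set.finite_range φ).exists_notMem
  refine of_card ?_ ?_ (hS.double (F.isBicoloring_const hc))
    (hF.double hc fun h => hc (hψ h)) ?_
  · simp only [Nat.card_sum, Nat.card_fin]
    omega
  · simp only [Nat.card_sum, Nat.card_fin]
    omega
  · simp only [Set.Sum.elim_range]
    rw [Set.union_comm]
    gcongr

theorem of_add_one_eq {b n : ℕ} (hb : HasBicoloredDoubling b) (hv : v + 1 = 2 ^ n * (b + 1)) :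
    HasBicoloredDoubling v := by
  induction n generalizing v with
  | zero => rwa [show v = b by omega]
  | succ n ih =>
    obtain ⟨u, hu⟩ := Nat.exists_eq_add_one_of_ne_zero (n := 2 ^ n * (b + 1)) (by positivity)
    have hvu : v = 2 * u + 1 := by rw [pow_succ'] at hv; lia
    exact hvu ▸ (ih hu.symm).double

theorem exists_hasExtendedBicoloring (h : HasBicoloredDoubling v) {w : ℕ} (hw : w = 2 * v + 1) :
    ∃ T : SteinerTripleSystem (Fin w), T.HasExtendedBicoloring ∧
      ∃ m n : ℕ, T.IsLowerChromaticNumber m ∧ T.IsUpperChromaticNumber n ∧ m ≠ n := by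
  obtain ⟨S, F, φ, ψ, hS, hF, hψ⟩ := h
  let e : Fin v ⊕ Fin (v + 1) ≃ Fin w := finSumFinEquiv.trans (finCongr (by omega))
  exact ⟨(S.double F).map e, S.hasExtendedBicoloring_map_double hS hF hψ e,
    SteinerTripleSystem.exists_lower_ne_upper_map_double hS hF hψ e⟩

end HasBicoloredDoubling

theorem mem_iff_mem_of_card_le_length {s : Finset V} {L : List V} (hnodup : L.Nodup)
    (hsub : ∀ a ∈ L, a ∈ s) (hcard : s.card ≤ L.length) {a : V} : a ∈ L ↔ a ∈ s := by
  classical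
  have : L.toFinset = s := Finset.eq_of_subset_of_card_le (fun a ha => hsub a (by simpa using ha))
    (by rwa [List.toFinset_card_of_nodup hnodup])
  rw [← this, List.mem_toFinset]

namespace SteinerTripleSystem

/-- The system whose triples are the sets `{x, y, z}` with `r x y z`. -/
def ofRel [DecidableEq V] (r : V → V → V → Prop) (swap : ∀ x y z, r x y z → r y x z)
    (rotate : ∀ x y z, r x y z → r y z x) (ne : ∀ x y z, r x y z → x ≠ y)
    (third : ∀ x y, x ≠ y → ∃! z, r x y z) : SteinerTripleSystem V where
  triples := {B | ∃ x y z, r x y z ∧ {x, y, z} = B}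
  card_eq_three := by
    rintro _ ⟨x, y, z, h, rfl⟩
    have hyz := rotate x y z h
    exact Finset.card_eq_three.2
      ⟨x, y, z, ne x y z h, (ne z x y (rotate y z x hyz)).symm, ne y z x hyz, rfl⟩
  existsUnique_triple x y hxy := by
    obtain ⟨z, hz, huniq⟩ := third x y hxy
    refine ⟨{x, y, z}, ⟨⟨x, y, z, hz, rfl⟩, by simp⟩, ?_⟩
    rintro _ ⟨⟨a, b, c, habc, rfl⟩, hx, hy⟩
    simp only [Finset.mem_insert, Finset.mem_singleton] at hx hy
    grind

/-- The six orderings of the triple `{x, y, z}`. -/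
def orderings : V × V × V → List (V × V × V)
  | (x, y, z) => [(x, y, z), (y, x, z), (x, z, y), (z, x, y), (y, z, x), (z, y, x)]

/-- The ordered pairs of points covered by the listed triples, with repetitions. -/
def coveredPairs (L : List (V × V × V)) : List (V × V) :=
  (L.flatMap orderings).map fun t => (t.1, t.2.1)

/-- The system of the listed triples. -/
def ofList [DecidableEq V] (L : List (V × V × V)) (hnodup : (coveredPairs L).Nodup)
    (hmem : ∀ p, p ∈ coveredPairs L ↔ p.1 ≠ p.2) : SteinerTripleSystem V :=
  ofRel (fun x y z => (x, y, z) ∈ L.flatMap orderings)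
    (by simp only [List.mem_flatMap, orderings]; grind)
    (by simp only [List.mem_flatMap, orderings]; grind)
    (fun x y z h => (hmem (x, y)).1 (List.mem_map_of_mem h))
    (fun x y hxy => by
      obtain ⟨⟨x, y, z⟩, hz, ⟨⟩⟩ := List.mem_map.1 ((hmem (x, y)).2 hxy)
      refine ⟨z, hz, fun w hw => ?_⟩
      cases List.inj_on_of_nodup_map hnodup hz hw rfl
      rfl)

theorem isBicoloring_ofList [DecidableEq V] [DecidableEq C] {L : List (V × V × V)}
    {hnodup : (coveredPairs L).Nodup} {hmem : ∀ p, p ∈ coveredPairs L ↔ p.1 ≠ p.2} {φ : V → C}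
    (h : ∀ t ∈ L, ({φ t.1, φ t.2.1, φ t.2.2} : Finset C).card = 2) :
    (ofList L hnodup hmem).IsBicoloring φ := by
  rintro _ ⟨x, y, z, hxyz, rfl⟩
  obtain ⟨⟨a, b, c⟩, habc, hmem⟩ := List.mem_flatMap.1 hxyz
  have hset : ({x, y, z} : Finset V) = {a, b, c} := by
    simp only [orderings, List.mem_cons, Prod.mk.injEq, List.not_mem_nil] at hmem
    grind
  simpa [hset, Finset.image_insert] using h _ habc

end SteinerTripleSystem

namespace OneFactorization

/-- The two orientations of the edge `{x, y}` of the factor `i`. -/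
def orientations : ι × X × X → List (ι × X × X)
  | (i, x, y) => [(i, x, y), (i, y, x)]

/-- The pairs of a factor and a vertex covered by it, with repetitions. -/
def incidences (L : List (ι × X × X)) : List (ι × X) :=
  (L.flatMap orientations).map fun e => (e.1, e.2.1)

/-- The ordered pairs of vertices joined by the listed edges, with repetitions. -/
def joinedPairs (L : List (ι × X × X)) : List (X × X) :=
  (L.flatMap orientations).map Prod.snd

/-- The 1-factorization in which `{x, y}` is an edge of the factor `i` for each listed
`(i, x, y)`. -/
def ofList (L : List (ι × X × X)) (hinc : (incidences L).Nodup)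
    (hmem_inc : ∀ p, p ∈ incidences L) (hjoin : (joinedPairs L).Nodup)
    (hmem_join : ∀ p, p ∈ joinedPairs L ↔ p.1 ≠ p.2) : OneFactorization ι X :=
  ofAdj (fun i x y => (i, x, y) ∈ L.flatMap orientations)
    (by simp only [List.mem_flatMap, orientations]; grind)
    (fun i x h => (hmem_join (x, x)).1 (List.mem_map_of_mem h) rfl)
    (fun i x => by
      obtain ⟨⟨i, x, y⟩, hy, ⟨⟩⟩ := List.mem_map.1 (hmem_inc (i, x))
      refine ⟨y, hy, fun z hz => ?_⟩
      cases List.inj_on_of_nodup_map hinc hy hz rfl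
      rfl)
    (fun x y hxy => by
      obtain ⟨⟨i, x, y⟩, hi, ⟨⟩⟩ := List.mem_map.1 ((hmem_join (x, y)).2 hxy)
      refine ⟨i, hi, fun j hj => ?_⟩
      cases List.inj_on_of_nodup_map hjoin hi hj rfl
      rfl)

theorem isBicoloring_ofList [DecidableEq C] {L : List (ι × X × X)} {hinc : (incidences L).Nodup}
    {hmem_inc : ∀ p, p ∈ incidences L} {hjoin : (joinedPairs L).Nodup}
    {hmem_join : ∀ p, p ∈ joinedPairs L ↔ p.1 ≠ p.2} {φ : ι → C} {ψ : X → C}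
    (h : ∀ e ∈ L, ({φ e.1, ψ e.2.1, ψ e.2.2} : Finset C).card = 2) :
    (ofList L hinc hmem_inc hjoin hmem_join).IsBicoloring φ ψ := by
  intro i x y hxy
  obtain ⟨⟨j, a, b⟩, he, hmem⟩ := List.mem_flatMap.1 hxy
  simp only [orientations, List.mem_cons, Prod.mk.injEq, List.not_mem_nil, or_false] at hmem
  obtain ⟨rfl, rfl, rfl⟩ | ⟨rfl, rfl, rfl⟩ := hmem
  · exact h _ he
  · rw [Finset.pair_comm]
    exact h _ he

end OneFactorization

/-- The permutation which rotates consecutive intervals of the given lengths. -/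
def rotate : List ℕ → ℕ → ℕ
  | [], x => x
  | l :: ls, x => if x < l then (x + 1) % l else l + rotate ls (x - l)

/-- The coloring whose color classes are consecutive intervals of the given lengths. -/
def intervalColor : List ℕ → ℕ → ℕ
  | [], _ => 0
  | l :: ls, x => if x < l then 0 else intervalColor ls (x - l) + 1

/-- The orbits of `f` through the given base blocks, which are grouped by the length of their
orbit. -/
def develop (f : V → V) (orbits : List (ℕ × List V)) : List V :=
  orbits.flatMap fun o => o.2.flatMap fun b => List.iterate f b o.1

/-- Whether the numbers in the list are distinct and none of them is the position of a bit set
in the mask. -/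
def nodupBits : List ℕ → ℕ → Bool
  | [], _ => true
  | c :: cs, mask => !mask.testBit c && nodupBits cs (mask ||| 2 ^ c)

theorem nodup_and_testBit_eq_false_of_nodupBits {L : List ℕ} {mask : ℕ} (h : nodupBits L mask) :
    L.Nodup ∧ ∀ c ∈ L, mask.testBit c = false := by
  induction L generalizing mask with
  | nil => simp
  | cons c cs ih =>
    rw [nodupBits, Bool.and_eq_true, Bool.not_eq_true'] at h
    obtain ⟨hnodup, hmask⟩ := ih h.2
    simp only [Nat.testBit_or, Bool.or_eq_false_iff, Nat.testBit_two_pow,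
      decide_eq_false_iff_not] at hmask
    refine ⟨List.nodup_cons.2 ⟨fun hc => (hmask c hc).2 rfl, hnodup⟩, ?_⟩
    rintro d (_ | ⟨_, hd⟩)
    · exact h.1
    · exact (hmask d hd).1

/-- A fast version of `List.Nodup` for pairs, which numbers them and stores in a bit mask which
numbers have occurred. -/
def nodupPairs {m n : ℕ} (L : List (Fin m × Fin n)) : Bool :=
  nodupBits (L.map fun p => p.2 + n * p.1) 0

theorem nodup_of_nodupPairs {m n : ℕ} {L : List (Fin m × Fin n)} (h : nodupPairs L) : L.Nodup :=
  (nodup_and_testBit_eq_false_of_nodupBits h).1.of_map _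

/-- Whether `L` lists all pairs in `Fin m × Fin n` exactly once. -/
def enumeratesProd {m n : ℕ} (L : List (Fin m × Fin n)) : Bool :=
  nodupPairs L && m * n ≤ L.length

theorem nodup_and_mem_of_enumeratesProd {m n : ℕ} {L : List (Fin m × Fin n)}
    (h : enumeratesProd L) : L.Nodup ∧ ∀ p, p ∈ L := by
  obtain ⟨hnodup, hlength⟩ := Bool.and_eq_true_iff.1 h
  have hmem {p} := mem_iff_mem_of_card_le_length (s := Finset.univ) (nodup_of_nodupPairs hnodup)
    (by simp) (by simpa using hlength) (a := p)
  exact ⟨nodup_of_nodupPairs hnodup, fun p => hmem.2 (Finset.mem_univ p)⟩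

/-- Whether `L` lists all pairs of distinct elements of `Fin n` exactly once. -/
def enumeratesOffDiag {n : ℕ} (L : List (Fin n × Fin n)) : Bool :=
  nodupPairs L && (L.all fun p => p.1 ≠ p.2) && n * n - n ≤ L.length

theorem nodup_and_mem_iff_of_enumeratesOffDiag {n : ℕ} {L : List (Fin n × Fin n)}
    (h : enumeratesOffDiag L) : L.Nodup ∧ ∀ p, p ∈ L ↔ p.1 ≠ p.2 := by
  simp only [enumeratesOffDiag, Bool.and_eq_true, List.all_eq_true, decide_eq_true_eq] at h
  obtain ⟨⟨hnodup, hne⟩, hlength⟩ := h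
  have hmem {p} := mem_iff_mem_of_card_le_length (s := Finset.univ.offDiag)
    (nodup_of_nodupPairs hnodup) (by simpa using hne) (by simpa [Finset.offDiag_card] using hlength)
    (a := p)
  exact ⟨nodup_of_nodupPairs hnodup, fun p => by simpa using hmem (p := p)⟩

/-- A compressed description of an STS(`v`), of a 1-factorization and of a bicoloring of the
doubling construction. Each of the two designs has an automorphism whose cycles, and each coloring
has classes, which are consecutive intervals of points. -/
structure DoublingData (v : ℕ) where
  /-- the sizes of the color classes of the points of the STS(`v`) -/
  oldClasses : List ℕ
  /-- the sizes of the color classes of the vertices of the 1-factorization -/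
  newClasses : List ℕ
  /-- the cycle lengths of an automorphism of the STS(`v`) -/
  pointCycles : List ℕ
  /-- the base blocks of the STS(`v`), grouped by the length of their orbit -/
  blocks : List (ℕ × List (ℕ × ℕ × ℕ))
  /-- the cycle lengths of an automorphism of the 1-factorization on the 1-factors -/
  factorCycles : List ℕ
  /-- the cycle lengths of this automorphism on the vertices -/
  vertexCycles : List ℕ
  /-- the base edges, preceded by their 1-factor and grouped by the length of their orbit -/
  edges : List (ℕ × List (ℕ × ℕ × ℕ))

namespace DoublingData

variable {v : ℕ} [NeZero v] (d : DoublingData v)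

/-- The coloring of the points of the STS(`v`). -/
def oldColor (x : Fin v) : ℕ :=
  intervalColor d.oldClasses x

/-- The coloring of the vertices of the 1-factorization. -/
def newColor (x : Fin (v + 1)) : ℕ :=
  intervalColor d.newClasses x

/-- The triples of the STS(`v`). -/
def triples : List (Fin v × Fin v × Fin v) :=
  let f := rotate d.pointCycles
  (develop (Prod.map f (Prod.map f f)) d.blocks).map
    (Prod.map (Fin.ofNat v) (Prod.map (Fin.ofNat v) (Fin.ofNat v)))

/-- The edges of the 1-factorization, preceded by their 1-factor. -/
def factorEdges : List (Fin v × Fin (v + 1) × Fin (v + 1)) :=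
  let f := rotate d.vertexCycles
  (develop (Prod.map (rotate d.factorCycles) (Prod.map f f)) d.edges).map
    (Prod.map (Fin.ofNat v) (Prod.map (Fin.ofNat (v + 1)) (Fin.ofNat (v + 1))))

/-- Whether the data describe an STS(`v`), a 1-factorization and a bicoloring in
which every new color is also an old one. -/
def isValid : Bool :=
  enumeratesOffDiag (SteinerTripleSystem.coveredPairs d.triples) &&
  enumeratesProd (OneFactorization.incidences d.factorEdges) &&
  enumeratesOffDiag (OneFactorization.joinedPairs d.factorEdges) &&
  (d.triples.all fun t =>
    ({d.oldColor t.1, d.oldColor t.2.1, d.oldColor t.2.2} : Finset ℕ).card = 2) &&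
  (d.factorEdges.all fun e =>
    ({d.oldColor e.1, d.newColor e.2.1, d.newColor e.2.2} : Finset ℕ).card = 2) &&
  ∀ x, ∃ a, d.oldColor a = d.newColor x

theorem hasBicoloredDoubling (h : d.isValid) : HasBicoloredDoubling v := by
  simp only [isValid, Bool.and_eq_true, List.all_eq_true, decide_eq_true_eq] at h
  obtain ⟨⟨⟨⟨⟨hpairs, hinc⟩, hjoin⟩, hS⟩, hF⟩, hrange⟩ := h
  obtain ⟨hpairs, hmem_pairs⟩ := nodup_and_mem_iff_of_enumeratesOffDiag hpairs
  obtain ⟨hinc, hmem_inc⟩ := nodup_and_mem_of_enumeratesProd hinc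
  obtain ⟨hjoin, hmem_join⟩ := nodup_and_mem_iff_of_enumeratesOffDiag hjoin
  exact ⟨.ofList d.triples hpairs hmem_pairs,
    .ofList d.factorEdges hinc hmem_inc hjoin hmem_join, d.oldColor, d.newColor,
    SteinerTripleSystem.isBicoloring_ofList hS, OneFactorization.isBicoloring_ofList hF,
    Set.range_subset_iff.2 hrange⟩

end DoublingData

/-- A 3-colored STS(13) with an automorphism of order 2, and a 1-factorization of the complete graph
on 14 vertices with an automorphism of order 5. -/
def doublingData13 : DoublingData 13 where
  oldClasses := [6, 5, 2]
  newClasses := [6, 1, 7]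
  pointCycles := [2, 2, 2, 2, 2, 1, 1, 1]
  blocks :=
    [(2, [(0, 2, 8), (0, 3, 6), (0, 4, 11), (0, 5, 9), (0, 7, 10), (2, 4, 12), (2, 5, 6),
        (2, 9, 10), (4, 6, 9), (6, 8, 11)]),
     (1, [(0, 1, 12), (2, 3, 11), (4, 5, 10), (6, 7, 12), (8, 9, 12), (10, 11, 12)])]
  factorCycles := [5, 1, 5, 1, 1]
  vertexCycles := [5, 1, 1, 5, 1, 1]
  edges :=
    [(5, [(0, 0, 13), (0, 1, 11), (0, 2, 8), (0, 3, 6), (0, 4, 12), (0, 5, 9), (0, 7, 10),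
        (5, 0, 9), (6, 0, 3), (6, 1, 2), (6, 4, 5), (6, 6, 10), (6, 7, 13), (6, 8, 9), (6, 11, 12),
        (11, 0, 8), (12, 0, 7)]),
     (1, [(5, 5, 6), (5, 12, 13), (11, 5, 13), (11, 6, 12), (12, 5, 12), (12, 6, 13)])]

theorem hasBicoloredDoubling_13 : HasBicoloredDoubling 13 :=
  doublingData13.hasBicoloredDoubling (by decide +kernel)

/-- A 4-colored STS(19) with an automorphism of order 4, and a 1-factorization of the complete graph
on 20 vertices with an automorphism of order 8. -/
def doublingData19 : DoublingData 19 where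
  oldClasses := [8, 8, 2, 1]
  newClasses := [0, 10, 10, 0]
  pointCycles := [4, 4, 4, 4, 1, 1, 1]
  blocks :=
    [(4, [(0, 1, 11), (0, 4, 17), (0, 5, 16), (0, 6, 8), (0, 7, 13), (0, 9, 14), (0, 12, 15),
        (4, 5, 12), (4, 8, 9), (4, 11, 13), (8, 12, 16), (8, 15, 17)]),
     (2, [(0, 2, 18), (4, 6, 18), (8, 10, 18), (12, 14, 18)]),
     (1, [(16, 17, 18)])]
  factorCycles := [8, 8, 1, 1, 1]
  vertexCycles := [8, 1, 1, 8, 1, 1]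
  edges :=
    [(8, [(0, 0, 1), (0, 2, 9), (0, 3, 6), (0, 4, 8), (0, 5, 7), (0, 10, 11), (0, 12, 19),
        (0, 13, 16), (0, 14, 18), (0, 15, 17), (8, 0, 10), (8, 1, 15), (8, 2, 19), (8, 3, 16),
        (8, 4, 18), (8, 5, 12), (8, 6, 17), (8, 7, 11), (8, 8, 14), (8, 9, 13), (16, 0, 16),
        (17, 0, 17)]),
     (4, [(18, 0, 4), (18, 10, 14)]),
     (1, [(16, 8, 18), (16, 9, 19), (17, 8, 19), (17, 9, 18), (18, 8, 9), (18, 18, 19)])]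

theorem hasBicoloredDoubling_19 : HasBicoloredDoubling 19 :=
  doublingData19.hasBicoloredDoubling (by decide +kernel)

/-- A 3-colored STS(21) with an automorphism of order 5, and a 1-factorization of the complete graph
on 22 vertices with an automorphism of order 5. -/
def doublingData21 : DoublingData 21 where
  oldClasses := [10, 6, 5]
  newClasses := [7, 10, 5]
  pointCycles := [5, 5, 5, 1, 5]
  blocks :=
    [(5, [(0, 1, 10), (0, 2, 13), (0, 5, 12), (0, 6, 16), (0, 7, 18), (0, 8, 17), (0, 9, 15),
        (0, 19, 20), (5, 6, 18), (5, 7, 10), (5, 11, 14), (10, 11, 16), (10, 15, 18),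
        (10, 17, 19)])]
  factorCycles := [5, 5, 5, 1, 5]
  vertexCycles := [5, 1, 1, 5, 5, 5]
  edges :=
    [(5, [(0, 0, 12), (0, 1, 9), (0, 2, 16), (0, 3, 21), (0, 4, 14), (0, 5, 8), (0, 6, 7),
        (0, 10, 11), (0, 13, 15), (0, 17, 20), (0, 18, 19), (5, 0, 11), (5, 1, 12), (5, 2, 19),
        (5, 3, 17), (5, 4, 20), (5, 5, 18), (5, 6, 21), (5, 7, 14), (5, 8, 16), (5, 9, 13),
        (5, 10, 15), (10, 0, 1), (10, 2, 9), (10, 3, 7), (10, 4, 12), (10, 5, 15), (10, 6, 14),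
        (10, 8, 17), (10, 10, 18), (10, 11, 21), (10, 13, 20), (10, 16, 19), (15, 0, 10),
        (15, 12, 18), (16, 0, 5), (16, 1, 3), (16, 2, 6), (16, 4, 19), (16, 7, 10), (16, 8, 20),
        (16, 9, 15), (16, 11, 17), (16, 12, 13), (16, 14, 18), (16, 16, 21)]),
     (1, [(15, 5, 6)])]

theorem hasBicoloredDoubling_21 : HasBicoloredDoubling 21 :=
  doublingData21.hasBicoloredDoubling (by decide +kernel)

/-- A 4-colored STS(25) with an automorphism of order 4, and a 1-factorization of the complete graph
on 26 vertices with an automorphism of order 4. -/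
def doublingData25 : DoublingData 25 where
  oldClasses := [12, 8, 4, 1]
  newClasses := [8, 12, 6, 0]
  pointCycles := [4, 4, 4, 4, 4, 4, 1]
  blocks :=
    [(4, [(0, 1, 23), (0, 4, 21), (0, 5, 20), (0, 6, 19), (0, 7, 18), (0, 8, 17), (0, 9, 16),
        (0, 10, 15), (0, 11, 14), (0, 12, 13), (4, 5, 15), (4, 8, 22), (4, 9, 20), (4, 10, 18),
        (4, 11, 13), (4, 12, 16), (8, 9, 21), (8, 12, 18), (12, 17, 23), (12, 19, 22), (12, 20, 21),
        (16, 17, 21)]),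
     (2, [(0, 2, 24), (4, 6, 24), (8, 10, 24), (12, 14, 24), (16, 18, 24), (20, 22, 24)])]
  factorCycles := [4, 4, 4, 4, 4, 4, 1]
  vertexCycles := [4, 4, 4, 4, 4, 4, 1, 1]
  edges :=
    [(4, [(0, 0, 24), (0, 1, 14), (0, 2, 18), (0, 3, 15), (0, 4, 20), (0, 5, 23), (0, 6, 19),
        (0, 7, 22), (0, 8, 9), (0, 10, 12), (0, 11, 17), (0, 13, 16), (0, 21, 25), (4, 0, 14),
        (4, 1, 9), (4, 2, 25), (4, 3, 22), (4, 4, 21), (4, 5, 19), (4, 6, 24), (4, 7, 10),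
        (4, 8, 17), (4, 11, 18), (4, 12, 13), (4, 15, 16), (4, 20, 23), (8, 0, 20), (8, 1, 11),
        (8, 2, 23), (8, 3, 21), (8, 4, 15), (8, 5, 9), (8, 6, 25), (8, 7, 12), (8, 8, 16),
        (8, 10, 14), (8, 13, 17), (8, 18, 19), (8, 22, 24), (12, 0, 17), (12, 1, 12), (12, 2, 5),
        (12, 3, 8), (12, 4, 19), (12, 6, 11), (12, 7, 13), (12, 9, 24), (12, 10, 22), (12, 14, 23),
        (12, 15, 25), (12, 16, 21), (12, 18, 20), (16, 0, 19), (16, 1, 8), (16, 2, 16), (16, 3, 4),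
        (16, 5, 17), (16, 6, 14), (16, 7, 9), (16, 10, 20), (16, 11, 25), (16, 12, 22),
        (16, 13, 24), (16, 15, 23), (16, 18, 21), (20, 0, 1), (20, 2, 6), (20, 3, 5), (20, 4, 7),
        (20, 8, 15), (20, 9, 14), (20, 10, 23), (20, 11, 22), (20, 12, 18), (20, 13, 20),
        (20, 16, 25), (20, 17, 21), (20, 19, 24)]),
     (2, [(24, 0, 2), (24, 4, 6), (24, 8, 10), (24, 12, 14), (24, 16, 18), (24, 20, 22)]),
     (1, [(24, 24, 25)])]

theorem hasBicoloredDoubling_25 : HasBicoloredDoubling 25 :=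
  doublingData25.hasBicoloredDoubling (by decide +kernel)

/-- A 3-colored STS(31) with an automorphism of order 7, and a 1-factorization of the complete graph
on 32 vertices with an automorphism of order 7. -/
def doublingData31 : DoublingData 31 where
  oldClasses := [14, 9, 8]
  newClasses := [8, 16, 8]
  pointCycles := [7, 7, 7, 1, 1, 7, 1]
  blocks :=
    [(7, [(0, 1, 14), (0, 2, 27), (0, 3, 24), (0, 7, 30), (0, 8, 22), (0, 9, 21), (0, 10, 23),
        (0, 11, 29), (0, 12, 26), (0, 13, 16), (0, 15, 19), (0, 17, 18), (7, 8, 16), (7, 9, 20),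
        (7, 10, 29), (7, 14, 19), (7, 23, 24), (14, 21, 29), (14, 22, 26), (14, 23, 25),
        (14, 24, 28), (14, 27, 30)]),
     (1, [(21, 22, 30)])]
  factorCycles := [7, 7, 7, 1, 1, 7, 1]
  vertexCycles := [7, 1, 7, 7, 1, 1, 7, 1]
  edges :=
    [(7, [(0, 0, 31), (0, 1, 24), (0, 2, 29), (0, 3, 27), (0, 4, 26), (0, 5, 23), (0, 6, 25),
        (0, 7, 20), (0, 8, 11), (0, 9, 14), (0, 10, 22), (0, 12, 18), (0, 13, 15), (0, 16, 17),
        (0, 19, 21), (0, 28, 30), (7, 0, 14), (7, 1, 10), (7, 2, 17), (7, 3, 20), (7, 4, 29),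
        (7, 5, 8), (7, 6, 18), (7, 7, 26), (7, 9, 21), (7, 11, 23), (7, 12, 13), (7, 15, 22),
        (7, 16, 19), (7, 24, 30), (7, 25, 28), (7, 27, 31), (14, 0, 20), (14, 1, 12), (14, 2, 16),
        (14, 3, 11), (14, 4, 9), (14, 5, 22), (14, 6, 17), (14, 7, 8), (14, 10, 30), (14, 13, 28),
        (14, 14, 24), (14, 15, 29), (14, 18, 27), (14, 19, 25), (14, 21, 31), (14, 23, 26),
        (21, 0, 13), (21, 15, 27), (22, 0, 16), (22, 8, 29), (23, 0, 4), (23, 1, 6), (23, 2, 3),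
        (23, 5, 7), (23, 8, 15), (23, 9, 19), (23, 10, 26), (23, 11, 29), (23, 12, 24),
        (23, 13, 21), (23, 14, 31), (23, 16, 27), (23, 17, 25), (23, 18, 28), (23, 20, 23),
        (23, 22, 30), (30, 0, 28), (30, 8, 19)]),
     (1, [(21, 7, 23), (21, 22, 31), (22, 7, 22), (22, 23, 31), (30, 7, 31), (30, 22, 23)])]

theorem hasBicoloredDoubling_31 : HasBicoloredDoubling 31 :=
  doublingData31.hasBicoloredDoubling (by decide +kernel)

/-- A 4-colored STS(33) with an automorphism of order 2, and a 1-factorization of the complete graph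
on 34 vertices with an automorphism of order 5. -/
def doublingData33 : DoublingData 33 where
  oldClasses := [16, 10, 5, 2]
  newClasses := [16, 10, 1, 7]
  pointCycles := [2, 2, 2, 2, 2, 2, 2, 2, 2, 2, 2, 2, 2, 2, 2, 1, 1, 1]
  blocks :=
    [(2, [(0, 2, 16), (0, 3, 18), (0, 4, 17), (0, 5, 19), (0, 6, 20), (0, 7, 22), (0, 8, 21),
        (0, 9, 23), (0, 10, 24), (0, 11, 26), (0, 12, 25), (0, 13, 32), (0, 14, 28), (0, 15, 31),
        (0, 27, 29), (2, 4, 20), (2, 5, 17), (2, 6, 18), (2, 7, 23), (2, 8, 24), (2, 9, 21),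
        (2, 10, 32), (2, 11, 27), (2, 12, 28), (2, 13, 31), (2, 14, 29), (2, 15, 26), (2, 22, 25),
        (4, 6, 19), (4, 7, 24), (4, 8, 29), (4, 9, 26), (4, 10, 31), (4, 11, 28), (4, 12, 23),
        (4, 13, 27), (4, 14, 22), (4, 15, 32), (4, 21, 25), (6, 8, 32), (6, 9, 27), (6, 10, 21),
        (6, 11, 29), (6, 12, 16), (6, 13, 28), (6, 14, 17), (6, 15, 24), (6, 26, 30), (8, 10, 16),
        (8, 11, 18), (8, 12, 17), (8, 13, 19), (8, 14, 23), (8, 15, 25), (8, 28, 30), (10, 12, 22),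
        (10, 13, 25), (10, 14, 18), (10, 15, 20), (10, 17, 23), (12, 14, 20), (12, 15, 27),
        (12, 19, 21), (14, 16, 19), (16, 18, 29), (16, 20, 28), (16, 21, 26), (16, 23, 32),
        (16, 24, 31), (16, 25, 27), (18, 21, 32), (18, 22, 26), (18, 23, 31), (18, 24, 27),
        (18, 25, 28), (20, 22, 29), (20, 23, 26), (20, 25, 30), (22, 24, 28), (26, 29, 32)]),
     (1, [(0, 1, 30), (2, 3, 30), (4, 5, 30), (6, 7, 31), (8, 9, 31), (10, 11, 30), (12, 13, 30),
        (14, 15, 30), (16, 17, 30), (18, 19, 30), (20, 21, 31), (22, 23, 30), (24, 25, 32),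
        (26, 27, 31), (28, 29, 31), (30, 31, 32)])]
  factorCycles := [5, 5, 5, 1, 5, 5, 5, 1, 1]
  vertexCycles := [5, 5, 5, 1, 5, 5, 1, 5, 1, 1]
  edges :=
    [(5, [(0, 0, 16), (0, 1, 24), (0, 2, 23), (0, 3, 20), (0, 4, 17), (0, 5, 29), (0, 6, 18),
        (0, 7, 33), (0, 8, 19), (0, 9, 26), (0, 10, 25), (0, 11, 22), (0, 12, 27), (0, 13, 31),
        (0, 14, 32), (0, 15, 21), (0, 28, 30), (5, 0, 19), (5, 1, 25), (5, 2, 22), (5, 3, 18),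
        (5, 4, 21), (5, 5, 20), (5, 6, 32), (5, 7, 16), (5, 8, 31), (5, 9, 17), (5, 10, 26),
        (5, 11, 27), (5, 12, 29), (5, 13, 33), (5, 14, 28), (5, 15, 30), (5, 23, 24), (10, 0, 27),
        (10, 1, 26), (10, 2, 32), (10, 3, 31), (10, 4, 33), (10, 5, 30), (10, 6, 28), (10, 7, 25),
        (10, 8, 29), (10, 9, 24), (10, 10, 16), (10, 11, 23), (10, 12, 21), (10, 13, 20),
        (10, 14, 22), (10, 15, 17), (10, 18, 19), (15, 0, 29), (15, 5, 21), (15, 10, 18),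
        (16, 0, 1), (16, 2, 4), (16, 3, 8), (16, 5, 6), (16, 7, 15), (16, 9, 23), (16, 10, 11),
        (16, 12, 14), (16, 13, 17), (16, 16, 27), (16, 18, 26), (16, 19, 31), (16, 20, 28),
        (16, 21, 29), (16, 22, 32), (16, 24, 30), (16, 25, 33), (21, 0, 6), (21, 1, 13),
        (21, 2, 12), (21, 3, 5), (21, 4, 7), (21, 8, 25), (21, 9, 14), (21, 10, 15), (21, 11, 16),
        (21, 17, 33), (21, 18, 28), (21, 19, 32), (21, 20, 29), (21, 21, 30), (21, 22, 27),
        (21, 23, 26), (21, 24, 31), (26, 0, 9), (26, 1, 14), (26, 2, 15), (26, 3, 12), (26, 4, 10),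
        (26, 5, 13), (26, 6, 8), (26, 7, 11), (26, 16, 18), (26, 17, 21), (26, 19, 24),
        (26, 20, 22), (26, 23, 25), (26, 26, 29), (26, 27, 28), (26, 30, 33), (26, 31, 32),
        (31, 0, 31), (31, 5, 12), (31, 16, 22), (32, 0, 30), (32, 5, 11), (32, 16, 24)]),
     (1, [(15, 15, 26), (15, 32, 33), (31, 15, 32), (31, 26, 33), (32, 15, 33), (32, 26, 32)])]

theorem hasBicoloredDoubling_33 : HasBicoloredDoubling 33 :=
  doublingData33.hasBicoloredDoubling (by decide +kernel)

/-- A 3-colored STS(37) with an automorphism of order 5, and a 1-factorization of the complete graph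
on 38 vertices with an automorphism of order 7. -/
def doublingData37 : DoublingData 37 where
  oldClasses := [16, 12, 9]
  newClasses := [4, 18, 16]
  pointCycles := [5, 5, 5, 1, 5, 5, 1, 1, 5, 1, 1, 1, 1]
  blocks :=
    [(5, [(0, 1, 25), (0, 2, 23), (0, 5, 16), (0, 6, 30), (0, 7, 27), (0, 8, 35), (0, 9, 29),
        (0, 10, 19), (0, 11, 34), (0, 12, 17), (0, 13, 26), (0, 14, 22), (0, 15, 31), (0, 18, 20),
        (0, 28, 36), (0, 32, 33), (5, 6, 22), (5, 7, 17), (5, 10, 32), (5, 11, 31), (5, 12, 33),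
        (5, 13, 36), (5, 14, 24), (5, 15, 18), (5, 19, 26), (5, 23, 25), (5, 28, 34), (10, 11, 17),
        (10, 12, 24), (10, 15, 21), (10, 18, 27), (10, 28, 35), (10, 29, 31), (16, 17, 31),
        (16, 21, 33), (16, 22, 36), (16, 23, 34), (16, 24, 35), (16, 25, 32), (16, 28, 29),
        (21, 22, 30), (21, 26, 32), (21, 27, 31)]),
     (1, [(15, 26, 27), (15, 33, 36), (15, 34, 35), (26, 33, 35), (26, 34, 36), (27, 33, 34),
        (27, 35, 36)])]
  factorCycles := [7, 7, 1, 1, 7, 1, 1, 1, 1, 1, 7, 1, 1]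
  vertexCycles := [1, 1, 1, 1, 7, 7, 1, 1, 1, 1, 7, 7, 1, 1]
  edges :=
    [(7, [(0, 0, 25), (0, 1, 6), (0, 2, 34), (0, 3, 17), (0, 4, 20), (0, 5, 9), (0, 7, 14),
        (0, 8, 13), (0, 10, 21), (0, 11, 19), (0, 12, 15), (0, 16, 18), (0, 22, 26), (0, 23, 28),
        (0, 24, 29), (0, 27, 37), (0, 30, 36), (0, 31, 33), (0, 32, 35), (7, 0, 10), (7, 1, 25),
        (7, 2, 17), (7, 3, 26), (7, 4, 18), (7, 5, 6), (7, 7, 11), (7, 8, 19), (7, 9, 12),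
        (7, 13, 21), (7, 14, 16), (7, 15, 20), (7, 22, 31), (7, 23, 34), (7, 24, 30), (7, 27, 36),
        (7, 28, 29), (7, 32, 33), (7, 35, 37), (14, 4, 13), (14, 22, 29), (15, 4, 17), (15, 22, 32),
        (16, 0, 17), (16, 1, 12), (16, 2, 6), (16, 3, 7), (16, 4, 30), (16, 5, 35), (16, 8, 29),
        (16, 9, 33), (16, 10, 36), (16, 11, 28), (16, 13, 27), (16, 14, 37), (16, 15, 23),
        (16, 16, 22), (16, 18, 24), (16, 19, 32), (16, 20, 31), (16, 21, 34), (16, 25, 26),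
        (23, 4, 33), (23, 11, 27), (24, 4, 24), (24, 11, 32), (25, 4, 26), (25, 11, 31),
        (26, 4, 22), (26, 11, 35), (27, 4, 25), (27, 11, 34), (28, 0, 31), (28, 1, 35), (28, 2, 22),
        (28, 3, 30), (28, 4, 6), (28, 5, 37), (28, 7, 24), (28, 8, 27), (28, 9, 29), (28, 10, 11),
        (28, 12, 36), (28, 13, 25), (28, 14, 33), (28, 15, 16), (28, 17, 32), (28, 18, 34),
        (28, 19, 23), (28, 20, 28), (28, 21, 26), (35, 4, 29), (35, 11, 22), (36, 4, 27),
        (36, 11, 29)]),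
     (1, [(14, 0, 37), (14, 1, 19), (14, 2, 36), (14, 3, 21), (14, 18, 20), (15, 0, 36),
        (15, 1, 20), (15, 2, 18), (15, 3, 37), (15, 19, 21), (23, 0, 1), (23, 2, 21), (23, 3, 19),
        (23, 18, 37), (23, 20, 36), (24, 0, 21), (24, 1, 2), (24, 3, 20), (24, 18, 36),
        (24, 19, 37), (25, 0, 20), (25, 1, 21), (25, 2, 19), (25, 3, 18), (25, 36, 37), (26, 0, 19),
        (26, 1, 18), (26, 2, 3), (26, 20, 37), (26, 21, 36), (27, 0, 18), (27, 1, 3), (27, 2, 20),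
        (27, 19, 36), (27, 21, 37), (35, 0, 3), (35, 1, 36), (35, 2, 37), (35, 18, 19),
        (35, 20, 21), (36, 0, 2), (36, 1, 37), (36, 3, 36), (36, 18, 21), (36, 19, 20)])]

theorem hasBicoloredDoubling_37 : HasBicoloredDoubling 37 :=
  doublingData37.hasBicoloredDoubling (by decide +kernel)

/-- A 4-colored STS(45) with an automorphism of order 4, and a 1-factorization of the complete graph
on 46 vertices with an automorphism of order 6. -/
def doublingData45 : DoublingData 45 where
  oldClasses := [22, 13, 6, 4]
  newClasses := [22, 12, 2, 10]
  pointCycles := [4, 4, 4, 4, 1, 1, 1, 1, 1, 1, 4, 4, 1, 1, 1, 1, 1, 4, 1, 1, 4]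
  blocks :=
    [(4, [(0, 1, 43), (0, 4, 33), (0, 5, 30), (0, 6, 40), (0, 7, 39), (0, 8, 24), (0, 9, 38),
        (0, 10, 23), (0, 11, 31), (0, 12, 36), (0, 13, 32), (0, 14, 35), (0, 15, 41), (0, 16, 44),
        (0, 17, 27), (0, 18, 29), (0, 19, 26), (0, 20, 37), (0, 21, 22), (0, 25, 28), (4, 5, 43),
        (4, 8, 28), (4, 9, 35), (4, 10, 41), (4, 11, 38), (4, 12, 23), (4, 13, 27), (4, 14, 26),
        (4, 15, 31), (4, 16, 37), (4, 17, 36), (4, 18, 24), (4, 19, 22), (4, 20, 25), (4, 21, 44),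
        (4, 29, 34), (8, 9, 42), (8, 12, 33), (8, 13, 40), (8, 14, 34), (8, 15, 39), (8, 16, 22),
        (8, 17, 23), (8, 18, 36), (8, 19, 44), (8, 20, 26), (8, 21, 29), (8, 27, 32), (12, 13, 25),
        (12, 16, 29), (12, 17, 43), (12, 18, 41), (12, 19, 38), (12, 20, 44), (12, 21, 35),
        (12, 22, 27), (22, 23, 43), (22, 26, 39), (22, 28, 36), (22, 30, 37), (22, 31, 35),
        (22, 32, 41), (22, 33, 44), (22, 34, 38), (26, 27, 43), (26, 30, 41), (26, 31, 44),
        (26, 33, 37), (26, 35, 36), (35, 39, 41), (35, 40, 42), (35, 43, 44)]),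
     (2, [(0, 2, 34), (4, 6, 32), (8, 10, 30), (12, 14, 30), (22, 24, 40), (26, 28, 40),
        (32, 35, 37), (34, 41, 43)]),
     (1, [(16, 17, 30), (16, 18, 40), (16, 19, 39), (16, 20, 32), (16, 21, 31), (16, 33, 34),
        (17, 18, 39), (17, 19, 32), (17, 20, 40), (17, 21, 34), (17, 31, 33), (18, 19, 34),
        (18, 20, 33), (18, 21, 30), (18, 31, 32), (19, 20, 31), (19, 21, 40), (19, 30, 33),
        (20, 21, 39), (20, 30, 34), (21, 32, 33), (30, 31, 40), (30, 32, 39), (31, 34, 39),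
        (32, 34, 40), (33, 39, 40)])]
  factorCycles := [6, 6, 6, 1, 1, 1, 1, 6, 6, 1, 6, 1, 1, 1, 1]
  vertexCycles := [6, 6, 6, 1, 1, 1, 1, 6, 6, 1, 1, 6, 1, 1, 1, 1]
  edges :=
    [(6, [(0, 0, 26), (0, 1, 38), (0, 2, 34), (0, 3, 29), (0, 4, 40), (0, 5, 35), (0, 6, 44),
        (0, 7, 45), (0, 8, 27), (0, 9, 23), (0, 10, 42), (0, 11, 30), (0, 12, 24), (0, 13, 33),
        (0, 14, 32), (0, 15, 31), (0, 16, 43), (0, 17, 28), (0, 18, 39), (0, 19, 25), (0, 20, 22),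
        (0, 21, 37), (0, 36, 41), (6, 0, 44), (6, 1, 24), (6, 2, 30), (6, 3, 25), (6, 4, 43),
        (6, 5, 42), (6, 6, 36), (6, 7, 29), (6, 8, 31), (6, 9, 26), (6, 10, 41), (6, 11, 35),
        (6, 12, 27), (6, 13, 38), (6, 14, 34), (6, 15, 45), (6, 16, 23), (6, 17, 32), (6, 18, 28),
        (6, 19, 33), (6, 20, 40), (6, 21, 22), (6, 37, 39), (12, 0, 30), (12, 1, 41), (12, 2, 45),
        (12, 3, 36), (12, 4, 23), (12, 5, 26), (12, 6, 22), (12, 7, 43), (12, 8, 34), (12, 9, 33),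
        (12, 10, 39), (12, 11, 31), (12, 12, 38), (12, 13, 24), (12, 14, 44), (12, 15, 42),
        (12, 16, 35), (12, 17, 40), (12, 18, 27), (12, 19, 37), (12, 20, 29), (12, 21, 32),
        (12, 25, 28), (18, 0, 41), (18, 6, 33), (18, 12, 26), (19, 0, 29), (19, 6, 24),
        (19, 12, 36), (20, 0, 24), (20, 6, 38), (20, 12, 31), (21, 0, 31), (21, 6, 27),
        (21, 12, 40), (22, 0, 7), (22, 1, 9), (22, 2, 12), (22, 3, 18), (22, 4, 5), (22, 6, 16),
        (22, 8, 19), (22, 10, 20), (22, 11, 13), (22, 14, 15), (22, 17, 21), (22, 22, 45),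
        (22, 23, 36), (22, 24, 35), (22, 25, 42), (22, 26, 43), (22, 27, 44), (22, 28, 41),
        (22, 29, 38), (22, 30, 40), (22, 31, 34), (22, 32, 37), (22, 33, 39), (28, 0, 21),
        (28, 1, 6), (28, 2, 15), (28, 3, 7), (28, 4, 12), (28, 5, 14), (28, 8, 9), (28, 10, 13),
        (28, 11, 18), (28, 16, 20), (28, 17, 19), (28, 22, 40), (28, 23, 37), (28, 24, 39),
        (28, 25, 41), (28, 26, 34), (28, 27, 38), (28, 28, 36), (28, 29, 45), (28, 30, 35),
        (28, 31, 42), (28, 32, 43), (28, 33, 44), (34, 0, 33), (34, 12, 22), (35, 0, 4),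
        (35, 1, 20), (35, 2, 19), (35, 3, 14), (35, 5, 11), (35, 6, 10), (35, 7, 12), (35, 8, 15),
        (35, 9, 21), (35, 13, 17), (35, 16, 18), (35, 22, 32), (35, 23, 24), (35, 25, 27),
        (35, 26, 28), (35, 29, 30), (35, 31, 33), (35, 34, 36), (35, 35, 41), (35, 37, 45),
        (35, 38, 42), (35, 39, 44), (35, 40, 43), (41, 0, 9), (41, 12, 39), (41, 22, 33),
        (42, 0, 38), (42, 6, 12), (42, 22, 29), (43, 6, 39), (43, 22, 28), (44, 0, 12),
        (44, 6, 40)]),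
     (3, [(34, 6, 9), (34, 36, 39), (43, 0, 3), (43, 12, 15), (44, 22, 25), (44, 28, 31)]),
     (1, [(18, 18, 34), (18, 19, 35), (18, 20, 42), (18, 21, 45), (18, 43, 44), (19, 18, 35),
        (19, 19, 34), (19, 20, 43), (19, 21, 42), (19, 44, 45), (20, 18, 45), (20, 19, 44),
        (20, 20, 34), (20, 21, 35), (20, 42, 43), (21, 18, 44), (21, 19, 43), (21, 20, 35),
        (21, 21, 34), (21, 42, 45), (34, 18, 19), (34, 20, 21), (34, 34, 35), (34, 42, 44),
        (34, 43, 45), (41, 18, 43), (41, 19, 21), (41, 20, 44), (41, 34, 45), (41, 35, 42),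
        (42, 18, 42), (42, 19, 20), (42, 21, 43), (42, 34, 44), (42, 35, 45), (43, 18, 21),
        (43, 19, 42), (43, 20, 45), (43, 34, 43), (43, 35, 44), (44, 18, 20), (44, 19, 45),
        (44, 21, 44), (44, 34, 42), (44, 35, 43)])]

theorem hasBicoloredDoubling_45 : HasBicoloredDoubling 45 :=
  doublingData45.hasBicoloredDoubling (by decide +kernel)

/-- A 5-colored STS(49) with an automorphism of order 10, and a 1-factorization of the complete
graph on 50 vertices with an automorphism of order 4. -/
def doublingData49 : DoublingData 49 where
  oldClasses := [20, 20, 4, 4, 1]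
  newClasses := [16, 22, 0, 12, 0]
  pointCycles := [10, 10, 10, 10, 1, 1, 1, 1, 1, 1, 1, 1, 1]
  blocks :=
    [(10, [(0, 1, 26), (0, 2, 20), (0, 3, 22), (0, 4, 21), (0, 10, 47), (0, 11, 23), (0, 12, 37),
        (0, 13, 46), (0, 14, 42), (0, 15, 43), (0, 16, 40), (0, 17, 41), (0, 18, 44), (0, 19, 48),
        (0, 24, 30), (0, 31, 39), (0, 32, 38), (0, 33, 36), (0, 34, 35), (10, 11, 37), (10, 12, 34),
        (10, 13, 31), (10, 14, 33), (10, 20, 21), (10, 23, 30), (10, 24, 27), (10, 25, 29),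
        (10, 26, 28), (20, 30, 43), (20, 31, 40), (20, 32, 44), (20, 33, 46), (20, 34, 41),
        (20, 35, 42), (20, 38, 48), (20, 39, 47)]),
     (5, [(0, 5, 45), (10, 15, 45), (20, 25, 45), (30, 35, 45)]),
     (1, [(40, 41, 45), (40, 42, 46), (40, 43, 48), (40, 44, 47), (41, 42, 48), (41, 43, 47),
        (41, 44, 46), (42, 43, 44), (42, 45, 47), (43, 45, 46), (44, 45, 48), (46, 47, 48)])]
  factorCycles := [4, 4, 4, 4, 4, 4, 4, 4, 4, 4, 4, 4, 1]
  vertexCycles := [4, 4, 4, 4, 4, 4, 4, 4, 4, 1, 1, 4, 4, 4]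
  edges :=
    [(4, [(0, 0, 39), (0, 1, 38), (0, 2, 49), (0, 3, 34), (0, 4, 37), (0, 5, 29), (0, 6, 40),
        (0, 7, 46), (0, 8, 45), (0, 9, 32), (0, 10, 26), (0, 11, 42), (0, 12, 24), (0, 13, 43),
        (0, 14, 48), (0, 15, 44), (0, 16, 17), (0, 18, 21), (0, 19, 23), (0, 20, 35), (0, 22, 31),
        (0, 25, 36), (0, 27, 30), (0, 28, 33), (0, 41, 47), (4, 0, 42), (4, 1, 44), (4, 2, 28),
        (4, 3, 41), (4, 4, 39), (4, 5, 30), (4, 6, 29), (4, 7, 40), (4, 8, 27), (4, 9, 46),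
        (4, 10, 48), (4, 11, 43), (4, 12, 25), (4, 13, 45), (4, 14, 23), (4, 15, 47), (4, 16, 37),
        (4, 17, 24), (4, 18, 31), (4, 19, 36), (4, 20, 33), (4, 21, 22), (4, 26, 32), (4, 34, 35),
        (4, 38, 49), (8, 0, 46), (8, 1, 41), (8, 2, 16), (8, 3, 27), (8, 4, 49), (8, 5, 44),
        (8, 6, 28), (8, 7, 45), (8, 8, 21), (8, 9, 19), (8, 10, 20), (8, 11, 40), (8, 12, 43),
        (8, 13, 38), (8, 14, 47), (8, 15, 39), (8, 17, 32), (8, 18, 23), (8, 22, 30), (8, 24, 33),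
        (8, 25, 31), (8, 26, 34), (8, 29, 36), (8, 35, 37), (8, 42, 48), (12, 0, 49), (12, 1, 22),
        (12, 2, 46), (12, 3, 44), (12, 4, 45), (12, 5, 36), (12, 6, 42), (12, 7, 39), (12, 8, 48),
        (12, 9, 41), (12, 10, 18), (12, 11, 37), (12, 12, 47), (12, 13, 34), (12, 14, 40),
        (12, 15, 33), (12, 16, 24), (12, 17, 35), (12, 19, 25), (12, 20, 32), (12, 21, 31),
        (12, 23, 30), (12, 26, 27), (12, 28, 29), (12, 38, 43), (16, 0, 16), (16, 1, 20),
        (16, 2, 17), (16, 3, 43), (16, 4, 22), (16, 5, 32), (16, 6, 46), (16, 7, 49), (16, 8, 28),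
        (16, 9, 48), (16, 10, 19), (16, 11, 45), (16, 12, 31), (16, 13, 33), (16, 14, 41),
        (16, 15, 34), (16, 18, 29), (16, 21, 27), (16, 23, 24), (16, 25, 37), (16, 26, 30),
        (16, 35, 36), (16, 38, 47), (16, 39, 42), (16, 40, 44), (20, 0, 34), (20, 1, 33),
        (20, 2, 35), (20, 3, 24), (20, 4, 25), (20, 5, 17), (20, 6, 22), (20, 7, 27), (20, 8, 19),
        (20, 9, 14), (20, 10, 13), (20, 11, 36), (20, 12, 15), (20, 16, 46), (20, 18, 43),
        (20, 20, 38), (20, 21, 48), (20, 23, 44), (20, 26, 45), (20, 28, 40), (20, 29, 39),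
        (20, 30, 41), (20, 31, 49), (20, 32, 42), (20, 37, 47), (24, 0, 29), (24, 1, 21),
        (24, 2, 20), (24, 3, 6), (24, 4, 7), (24, 5, 11), (24, 8, 23), (24, 9, 26), (24, 10, 22),
        (24, 12, 27), (24, 13, 16), (24, 14, 36), (24, 15, 28), (24, 17, 40), (24, 18, 45),
        (24, 19, 41), (24, 24, 44), (24, 25, 42), (24, 30, 46), (24, 31, 48), (24, 32, 49),
        (24, 33, 38), (24, 34, 43), (24, 35, 47), (24, 37, 39), (28, 0, 31), (28, 1, 8),
        (28, 2, 30), (28, 3, 25), (28, 4, 18), (28, 5, 34), (28, 6, 11), (28, 7, 33), (28, 9, 35),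
        (28, 10, 14), (28, 12, 26), (28, 13, 37), (28, 15, 17), (28, 16, 44), (28, 19, 39),
        (28, 20, 46), (28, 21, 40), (28, 22, 42), (28, 23, 48), (28, 24, 47), (28, 27, 49),
        (28, 28, 41), (28, 29, 45), (28, 32, 38), (28, 36, 43), (32, 0, 36), (32, 1, 6),
        (32, 2, 11), (32, 3, 26), (32, 4, 17), (32, 5, 22), (32, 7, 35), (32, 8, 32), (32, 9, 27),
        (32, 10, 12), (32, 13, 23), (32, 14, 28), (32, 15, 31), (32, 16, 47), (32, 18, 46),
        (32, 19, 48), (32, 20, 41), (32, 21, 44), (32, 24, 39), (32, 25, 43), (32, 29, 42),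
        (32, 30, 49), (32, 33, 40), (32, 34, 38), (32, 37, 45), (36, 0, 3), (36, 1, 37),
        (36, 2, 19), (36, 4, 26), (36, 5, 20), (36, 6, 25), (36, 7, 18), (36, 8, 31), (36, 9, 30),
        (36, 10, 35), (36, 11, 29), (36, 12, 23), (36, 13, 17), (36, 14, 22), (36, 15, 16),
        (36, 21, 41), (36, 24, 38), (36, 27, 40), (36, 28, 42), (36, 32, 47), (36, 33, 44),
        (36, 34, 48), (36, 36, 39), (36, 43, 46), (36, 45, 49), (40, 0, 10), (40, 1, 15),
        (40, 2, 4), (40, 3, 11), (40, 5, 13), (40, 6, 12), (40, 7, 14), (40, 8, 9), (40, 16, 25),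
        (40, 17, 33), (40, 18, 28), (40, 19, 31), (40, 20, 36), (40, 21, 35), (40, 22, 37),
        (40, 23, 26), (40, 24, 29), (40, 27, 34), (40, 30, 32), (40, 38, 46), (40, 39, 45),
        (40, 40, 41), (40, 42, 43), (40, 44, 49), (40, 47, 48), (44, 0, 4), (44, 1, 13),
        (44, 2, 15), (44, 3, 14), (44, 5, 8), (44, 6, 10), (44, 7, 12), (44, 9, 40), (44, 11, 41),
        (44, 16, 33), (44, 17, 23), (44, 18, 39), (44, 19, 45), (44, 20, 24), (44, 21, 49),
        (44, 22, 44), (44, 25, 46), (44, 26, 38), (44, 27, 47), (44, 28, 43), (44, 29, 32),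
        (44, 30, 37), (44, 31, 35), (44, 34, 42), (44, 36, 48)]),
     (2, [(48, 0, 2), (48, 4, 6), (48, 8, 10), (48, 12, 14), (48, 16, 18), (48, 20, 22),
        (48, 24, 26), (48, 28, 30), (48, 32, 34), (48, 38, 40), (48, 42, 44), (48, 46, 48)]),
     (1, [(48, 36, 37)])]

theorem hasBicoloredDoubling_49 : HasBicoloredDoubling 49 :=
  doublingData49.hasBicoloredDoubling (by decide +kernel)

/-- The orders of the base cases. -/
def baseOrders : Finset ℕ :=
  {13, 19, 21, 25, 31, 33, 37, 45, 49}

theorem hasBicoloredDoubling_of_mem_baseOrders {b : ℕ} (hb : b ∈ baseOrders) :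
    HasBicoloredDoubling b := by
  simp only [baseOrders, Finset.mem_insert, Finset.mem_singleton] at hb
  obtain rfl | rfl | rfl | rfl | rfl | rfl | rfl | rfl | rfl := hb
  exacts [hasBicoloredDoubling_13, hasBicoloredDoubling_19, hasBicoloredDoubling_21,
    hasBicoloredDoubling_25, hasBicoloredDoubling_31, hasBicoloredDoubling_33,
    hasBicoloredDoubling_37, hasBicoloredDoubling_45, hasBicoloredDoubling_49]

theorem theorem10_general {b k w : ℕ} (hb : b ∈ baseOrders) (hw : w + 1 = 2 ^ (k + 1) * (b + 1)) :
    ∃ T : SteinerTripleSystem (Fin w), T.HasExtendedBicoloring ∧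
      ∃ m n : ℕ, T.IsLowerChromaticNumber m ∧ T.IsUpperChromaticNumber n ∧ m ≠ n := by
  obtain ⟨v, hv⟩ := Nat.exists_eq_add_one_of_ne_zero (n := 2 ^ k * (b + 1)) (by positivity)
  have hwv : w = 2 * v + 1 := by rw [pow_succ'] at hw; lia
  have hb' : HasBicoloredDoubling b := hasBicoloredDoubling_of_mem_baseOrders hb
  exact (hb'.of_add_one_eq hv.symm).exists_hasExtendedBicoloring hwv

theorem theorem10 :
    ∀ w ∈ ({27, 39, 43, 55, 79, 87, 91, 99, 103, 111, 127, 135, 151, 159, 175} : Finset ℕ),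
      ∃ T : SteinerTripleSystem (Fin w), T.HasExtendedBicoloring ∧
        ∃ m n : ℕ, T.IsLowerChromaticNumber m ∧ T.IsUpperChromaticNumber n ∧ m ≠ n := by
  intro w hw
  obtain ⟨b, hb, k, -, h⟩ : ∃ b ∈ baseOrders, ∃ k < 3, w + 1 = 2 ^ (k + 1) * (b + 1) := by
    decide +revert
  exact theorem10_general hb h
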